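/- Let $\mathrm{Lie}[a,b]$ be the free Lie algebra over $\mathbb{Q}$ on two generators, and let $\mathrm{Der}^0$ be the Lie algebra of derivations $D$ of $\mathrm{Lie}[a,b]$ such that $D([a,b])=0$ and neither $D(a)$ nor $D(b)$ has a linear term in $a$, with bracket $[D_1,D_2]=D_1D_2-D_2D_1$. Put $C_i=\mathrm{ad}(a)^{i-1}(b)$ for $i\ge 1$, so that $\mathrm{Lie}[a,b]=\mathbb{Q}a\oplus\mathrm{Lie}[C_1,C_2,\dots]$, the second summand being free on the $C_i$. For $F\in \mathrm{Lie}[C_1,C_2,\dots]$, expanded as a noncommutative polynomial in the $C_i$, let $\mathrm{ma}(F)$ be the family $(\mathrm{ma}(F)_r)_{r\ge 0}$ obtained from the linear map $C_{i_1}\cdots C_{i_r}\mapsto (-1)^{i_1+\cdots+i_r-r}u_1^{i_1-1}\cdots u_r^{i_r-1}$, the degree $r$ part in the $C_i$ giving $\mathrm{ma}(F)_r\in\mathbb{Q}[u_1,\dots,u_r]$. A mould is a family $A=(A_r)_{r\ge 0}$ with $A_r\in\mathbb{Q}(u_1,\dots,u_r)$; write $A(u_1,\dots,u_r)$ for $A_r$.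 Let $\mathrm{ARI}$ be the $\mathbb{Q}$-vector space of moulds with $A_0=0$. For $A,B\in\mathrm{ARI}$ set $$\mathrm{ari}(A,B)=\mathrm{arit}(B)\cdot A-\mathrm{arit}(A)\cdot B+\mathrm{lu}(A,B),\qquad \mathrm{lu}(A,B)=\mathrm{mu}(A,B)-\mathrm{mu}(B,A),$$ $$\mathrm{mu}(A,B)(u_1,\dots,u_r)=\sum_{i=0}^rA(u_1,\dots,u_i)B(u_{i+1},\dots,u_r),$$ $$(\mathrm{arit}(B)\cdot A)(u_1,\dots,u_r)=\sum_{0\le k<\ell<r}A(u_1,\dots,u_k,u_{k+1}+\cdots+u_{\ell+1},u_{\ell+2},\dots,u_r)\,B(u_{k+1},\dots,u_\ell)$$ $$\qquad-\sum_{1\le k<\ell\le r}A(u_1,\dots,u_{k-1},u_k+\cdots+u_\ell,u_{\ell+1},\dots,u_r)\,B(u_{k+1},\dots,u_\ell).$$ Define $\Psi:\mathrm{Der}^0\to\mathrm{ARI}$ by $\Psi(D)_0=0$ and $$\Psi(D)(u_1,\dots,u_r)=\frac{\mathrm{ma}(D(a))(u_1,\dots,u_r)}{u_1\cdots u_r(u_1+\cdots+u_r)}\qquad(r\ge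 1).$$ Theorem. The map $\Psi$ is an injective Lie algebra morphism, that is, it is $\mathbb{Q}$-linear, injective, and for all $D_1,D_2\in\mathrm{Der}^0$ $$\Psi([D_1,D_2])=\mathrm{ari}\bigl(\Psi(D_1),\Psi(D_2)\bigr).$$ -/

import Mathlib

namespace EllipticMould

noncomputable section

/- Associative algebras carry the commutator bracket. -/
attribute [local instance 100] LieRing.ofAssociativeRing

/-! ### The free Lie algebra on `a`, `b` and its derivations -/

/-- The free Lie algebra `Lie[a,b]` over `ℚ`. -/
abbrev LieAB : Type := FreeLieAlgebra ℚ (Fin 2)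

/-- The generator `a`. -/
def genA : LieAB := FreeLieAlgebra.of ℚ 0

/-- The generator `b`. -/
def genB : LieAB := FreeLieAlgebra.of ℚ 1

/-- The coefficient of `a` in the linear part of an element of `Lie[a,b]`: the Lie morphism to the
abelian Lie algebra `ℚ` with `a ↦ 1`, `b ↦ 0`; it vanishes on all brackets. -/
def coeffA : LieAB →ₗ⁅ℚ⁆ ℚ := FreeLieAlgebra.lift ℚ ![1, 0]

theorem coeffA_genA : coeffA genA = 1 := by
  simp [coeffA, genA]

theorem coeffA_genB : coeffA genB = 0 := by
  simp [coeffA, genB]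

theorem coeffA_lie (x y : LieAB) : coeffA ⁅x, y⁆ = 0 := by
  rw [LieHom.map_lie, Ring.lie_def, mul_comm, sub_self]

/-- A derivation whose values on `a` and `b` have no linear term in `a` has no value with a linear
term in `a`. -/
theorem coeffA_derivation (D : LieDerivation ℚ LieAB LieAB) (ha : coeffA (D genA) = 0)
    (hb : coeffA (D genB) = 0) (x : LieAB) : coeffA (D x) = 0 := by
  let φ : LieAB →ₗ⁅ℚ⁆ ℚ :=
    { (coeffA : LieAB →ₗ[ℚ] ℚ) ∘ₗ (D : LieAB →ₗ[ℚ] LieAB) with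
      map_lie' := by
        intro x y
        change coeffA (D ⁅x, y⁆) = ⁅coeffA (D x), coeffA (D y)⁆
        rw [LieDerivation.apply_lie_eq_sub, map_sub, coeffA_lie, coeffA_lie, Ring.lie_def,
          mul_comm, sub_self, sub_self] }
  have h : φ = 0 := by
    apply FreeLieAlgebra.hom_ext
    intro i
    fin_cases i
    · exact ha
    · exact hb
  exact congrArg (fun f : LieAB →ₗ⁅ℚ⁆ ℚ => f x) h

/-- `Der⁰ Lie[a,b]`: the derivations of `Lie[a,b]` that kill `[a,b]` and whose values on `a` and
`b` have no linear term in `a`, as a Lie subalgebra of `Der Lie[a,b]` with the commutator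
bracket. -/
def Der0 : LieSubalgebra ℚ (LieDerivation ℚ LieAB LieAB) where
  carrier := {D | D ⁅genA, genB⁆ = 0 ∧ coeffA (D genA) = 0 ∧ coeffA (D genB) = 0}
  zero_mem' := by simp
  add_mem' := by
    rintro D E ⟨h1, h2, h3⟩ ⟨h4, h5, h6⟩
    simp only [Set.mem_ofPred_eq, LieDerivation.add_apply, map_add] at *
    simp [h1, h2, h3, h4, h5, h6]
  smul_mem' := by
    rintro c D ⟨h1, h2, h3⟩
    simp only [Set.mem_ofPred_eq, LieDerivation.smul_apply, map_smul] at *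
    simp [h1, h2, h3]
  lie_mem' := by
    rintro D E ⟨h1, h2, h3⟩ ⟨h4, h5, h6⟩
    simp only [Set.mem_ofPred_eq, LieDerivation.lie_apply, map_sub, h1, h4, map_zero, sub_self,
      coeffA_derivation D h2 h3, coeffA_derivation E h5 h6, and_self]

/-! ### Lazard elimination: `Lie[a,b] = ℚa ⊕ Lie[C₁, C₂, …]` with `Cᵢ = ad(a)^(i-1)(b)`

The index is shifted: the letter `n : ℕ` stands for `C_{n+1} = ad(a)^n (b)`. -/

/-- The noncommutative polynomial ring `ℚ⟨C₁, C₂, …⟩`. -/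
abbrev PolyC : Type := FreeAlgebra ℚ ℕ

/-- The Lie morphism `Lie[C₁, C₂, …] → Lie[a,b]` with `C_{n+1} ↦ ad(a)^n (b)`. -/
def expandC : FreeLieAlgebra ℚ ℕ →ₗ⁅ℚ⁆ LieAB :=
  FreeLieAlgebra.lift ℚ fun n => ((LieAlgebra.ad ℚ LieAB genA) ^ n) genB

/-- The canonical map `Lie[C₁, C₂, …] → ℚ⟨C₁, C₂, …⟩`, expanding brackets as commutators. -/
def assocC : FreeLieAlgebra ℚ ℕ →ₗ⁅ℚ⁆ PolyC :=
  FreeLieAlgebra.lift ℚ (FreeAlgebra.ι ℚ)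

/-- Auxiliary algebra morphism `P ↦ P + ε ∂P` for the derivation `∂` below. -/
def shiftHom : PolyC →ₐ[ℚ] TrivSqZeroExt PolyC PolyC :=
  FreeAlgebra.lift ℚ fun n =>
    TrivSqZeroExt.inl (FreeAlgebra.ι ℚ n) + TrivSqZeroExt.inr (FreeAlgebra.ι ℚ (n + 1))

/-- The derivation `∂` of `ℚ⟨C₁, C₂, …⟩` with `∂ Cᵢ = Cᵢ₊₁`, that is, the action of `ad(a)`. -/
def shiftC : PolyC →ₗ[ℚ] PolyC where
  toFun P := (shiftHom P).snd
  map_add' P Q := by rw [map_add, TrivSqZeroExt.snd_add]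
  map_smul' c P := by rw [map_smul, TrivSqZeroExt.snd_smul, RingHom.id_apply]

/-- The representation of `Lie[a,b]` on `ℚ⟨C₁, C₂, …⟩` in which `a` acts as `∂` and `b` as left
multiplication by `C₁`. -/
def actC : LieAB →ₗ⁅ℚ⁆ Module.End ℚ PolyC :=
  FreeLieAlgebra.lift ℚ ![shiftC, LinearMap.mulLeft ℚ (FreeAlgebra.ι ℚ 0)]

/-- The expression of an element of `Lie[a,b]` as a polynomial in the `Cᵢ`, its component in `ℚa`
being dropped. It is characterized by `toPolyC_eq` and `exists_eq_expandC`. -/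
def toPolyC : LieAB →ₗ[ℚ] PolyC where
  toFun F := actC F 1
  map_add' F G := by rw [map_add, LinearMap.add_apply]
  map_smul' c F := by rw [map_smul, LinearMap.smul_apply, RingHom.id_apply]

theorem shiftHom_fst (P : PolyC) : (shiftHom P).fst = P := by
  have h : (TrivSqZeroExt.fstHom ℚ PolyC PolyC).comp shiftHom = AlgHom.id ℚ PolyC := by
    ext n
    simp [shiftHom]
  exact congrArg (fun f : PolyC →ₐ[ℚ] PolyC => f P) h

theorem shiftC_ι (n : ℕ) : shiftC (FreeAlgebra.ι ℚ n) = FreeAlgebra.ι ℚ (n + 1) := by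
  change (shiftHom (FreeAlgebra.ι ℚ n)).snd = _
  simp [shiftHom]

theorem shiftC_one : shiftC 1 = 0 := by
  change (shiftHom 1).snd = _
  simp

theorem shiftC_mul (P Q : PolyC) : shiftC (P * Q) = shiftC P * Q + P * shiftC Q := by
  change (shiftHom (P * Q)).snd = (shiftHom P).snd * Q + P * (shiftHom Q).snd
  rw [map_mul, TrivSqZeroExt.snd_mul, shiftHom_fst, shiftHom_fst, add_comm]
  rfl

theorem actC_genA : actC genA = shiftC := by simp [actC, genA]

theorem actC_genB : actC genB = LinearMap.mulLeft ℚ (FreeAlgebra.ι ℚ 0) := by simp [actC, genB]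

theorem actC_ad (n : ℕ) : actC (((LieAlgebra.ad ℚ LieAB genA) ^ n) genB) =
    LinearMap.mulLeft ℚ (FreeAlgebra.ι ℚ n) := by
  induction n with
  | zero => simpa using actC_genB
  | succ n ih =>
    rw [pow_succ', Module.End.mul_apply, LieAlgebra.ad_apply, LieHom.map_lie, ih, actC_genA,
      Ring.lie_def]
    ext P
    simp [shiftC_mul, shiftC_ι]

theorem actC_expandC (P : FreeLieAlgebra ℚ ℕ) :
    actC (expandC P) = LinearMap.mulLeft ℚ (assocC P) := by
  let ψ : FreeLieAlgebra ℚ ℕ →ₗ⁅ℚ⁆ Module.End ℚ PolyC :=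
    { toFun := fun P => LinearMap.mulLeft ℚ (assocC P)
      map_add' := by intro x y; ext z; simp [add_mul]
      map_smul' := by intro c x; ext z; simp
      map_lie' := by
        intro x y
        ext z
        simp [Ring.lie_def, sub_mul, mul_assoc] }
  have h : actC.comp expandC = ψ := by
    apply FreeLieAlgebra.hom_ext
    intro n
    change actC (expandC (FreeLieAlgebra.of ℚ n)) =
      LinearMap.mulLeft ℚ (assocC (FreeLieAlgebra.of ℚ n))
    rw [expandC, assocC, FreeLieAlgebra.lift_of_apply, FreeLieAlgebra.lift_of_apply, actC_ad]
  exact congrArg (fun f : FreeLieAlgebra ℚ ℕ →ₗ⁅ℚ⁆ Module.End ℚ PolyC => f P) h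

/-- On `ℚa ⊕ Lie[C₁, C₂, …]`, `toPolyC` is the expansion of the second component. -/
theorem toPolyC_eq (c : ℚ) (P : FreeLieAlgebra ℚ ℕ) :
    toPolyC (c • genA + expandC P) = assocC P := by
  change actC (c • genA + expandC P) 1 = _
  rw [map_add, map_smul, actC_genA, actC_expandC]
  simp [shiftC_one]

/-- A Lie subalgebra containing the images of the generators contains the image of a free Lie
algebra. -/
theorem mem_of_generators {X M : Type} [LieRing M] [LieAlgebra ℚ M]
    (f : FreeLieAlgebra ℚ X →ₗ⁅ℚ⁆ M) (S : LieSubalgebra ℚ M)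
    (h : ∀ x, f (FreeLieAlgebra.of ℚ x) ∈ S) (P : FreeLieAlgebra ℚ X) : f P ∈ S := by
  let g : FreeLieAlgebra ℚ X →ₗ⁅ℚ⁆ S :=
    FreeLieAlgebra.lift ℚ fun x => ⟨f (FreeLieAlgebra.of ℚ x), h x⟩
  have hg : S.incl.comp g = f := by
    apply FreeLieAlgebra.hom_ext
    intro x
    simp [g]
  rw [← hg]
  exact (g P).2

theorem expandC_of (n : ℕ) :
    expandC (FreeLieAlgebra.of ℚ n) = ((LieAlgebra.ad ℚ LieAB genA) ^ n) genB := by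
  rw [expandC, FreeLieAlgebra.lift_of_apply]

theorem coeffA_expandC (P : FreeLieAlgebra ℚ ℕ) : coeffA (expandC P) = 0 := by
  have h : coeffA.comp expandC = 0 := by
    apply FreeLieAlgebra.hom_ext
    intro n
    change coeffA (expandC (FreeLieAlgebra.of ℚ n)) = 0
    rw [expandC_of]
    cases n with
    | zero => exact coeffA_genB
    | succ n => rw [pow_succ', Module.End.mul_apply, LieAlgebra.ad_apply, coeffA_lie]
  exact congrArg (fun f : FreeLieAlgebra ℚ ℕ →ₗ⁅ℚ⁆ ℚ => f P) h

theorem lie_genA_expandC (P : FreeLieAlgebra ℚ ℕ) : ⁅genA, expandC P⁆ ∈ expandC.range := by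
  let S : LieSubalgebra ℚ LieAB :=
    { carrier := {x | x ∈ expandC.range ∧ ⁅genA, x⁆ ∈ expandC.range}
      zero_mem' := by
        refine ⟨zero_mem _, ?_⟩
        rw [lie_zero]
        exact zero_mem _
      add_mem' := by
        rintro x y ⟨h1, h2⟩ ⟨h3, h4⟩
        refine ⟨add_mem h1 h3, ?_⟩
        rw [lie_add]
        exact add_mem h2 h4
      smul_mem' := by
        rintro c x ⟨h1, h2⟩
        refine ⟨expandC.range.smul_mem c h1, ?_⟩
        rw [lie_smul]
        exact expandC.range.smul_mem c h2
      lie_mem' := by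
        rintro x y ⟨h1, h2⟩ ⟨h3, h4⟩
        refine ⟨expandC.range.lie_mem h1 h3, ?_⟩
        rw [leibniz_lie]
        exact add_mem (expandC.range.lie_mem h2 h3) (expandC.range.lie_mem h1 h4) }
  refine (mem_of_generators expandC S (fun n => ⟨⟨_, rfl⟩, ?_⟩) P).2
  refine ⟨FreeLieAlgebra.of ℚ (n + 1), ?_⟩
  rw [LieHom.coe_toLinearMap, expandC_of, expandC_of, pow_succ', Module.End.mul_apply,
    LieAlgebra.ad_apply]

/-- Every `F` in `Lie[a,b]` is the sum of its linear term in `a` and of a Lie polynomial in the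
`Cᵢ`. -/
theorem exists_eq_expandC (F : LieAB) :
    ∃ P : FreeLieAlgebra ℚ ℕ, F = coeffA F • genA + expandC P := by
  let S : LieSubalgebra ℚ LieAB :=
    { carrier := {x | ∃ c : ℚ, ∃ y ∈ expandC.range, x = c • genA + y}
      zero_mem' := ⟨0, 0, zero_mem _, by simp⟩
      add_mem' := by
        rintro _ _ ⟨c, x, hx, rfl⟩ ⟨d, y, hy, rfl⟩
        exact ⟨c + d, x + y, add_mem hx hy, by rw [add_smul]; abel⟩
      smul_mem' := by
        rintro t _ ⟨c, x, hx, rfl⟩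
        exact ⟨t * c, t • x, expandC.range.smul_mem t hx, by rw [smul_add, smul_smul]⟩
      lie_mem' := by
        rintro _ _ ⟨c, _, ⟨x, rfl⟩, rfl⟩ ⟨d, _, ⟨y, rfl⟩, rfl⟩
        refine ⟨0, c • ⁅genA, expandC y⁆ - d • ⁅genA, expandC x⁆ + ⁅expandC x, expandC y⁆,
          add_mem (sub_mem (expandC.range.smul_mem c (lie_genA_expandC y))
            (expandC.range.smul_mem d (lie_genA_expandC x)))
            (expandC.range.lie_mem ⟨x, rfl⟩ ⟨y, rfl⟩), ?_⟩
        simp only [LieHom.coe_toLinearMap, add_lie, lie_add, smul_lie, lie_smul, lie_self,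
          smul_zero, zero_smul, zero_add]
        rw [← lie_skew (expandC x) genA, smul_neg]
        abel }
  have h : F ∈ S := by
    refine mem_of_generators (LieHom.id : LieAB →ₗ⁅ℚ⁆ LieAB) S (fun i => ?_) F
    fin_cases i
    · exact ⟨1, 0, zero_mem _, by simp [genA]⟩
    · exact ⟨0, genB, ⟨FreeLieAlgebra.of ℚ 0, expandC_of 0⟩,
        by simp [genB]⟩
  obtain ⟨c, _, ⟨P, rfl⟩, h⟩ := h
  refine ⟨P, ?_⟩
  have hc : coeffA F = c := by
    rw [h, LieHom.coe_toLinearMap, map_add, map_smul, coeffA_genA, coeffA_expandC]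
    simp
  rw [hc]
  exact h

/-! ### Moulds -/

/-- Rational functions over `ℚ` in the commutative variables `u₁, …, u_r`. -/
def RatFun (r : ℕ) : Type := FractionRing (MvPolynomial (Fin r) ℚ)

instance (r : ℕ) : Field (RatFun r) :=
  inferInstanceAs (Field (FractionRing (MvPolynomial (Fin r) ℚ)))

instance (r : ℕ) : Algebra (MvPolynomial (Fin r) ℚ) (RatFun r) :=
  inferInstanceAs (Algebra (MvPolynomial (Fin r) ℚ) (FractionRing (MvPolynomial (Fin r) ℚ)))

instance (r : ℕ) : IsFractionRing (MvPolynomial (Fin r) ℚ) (RatFun r) :=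
  inferInstanceAs (IsFractionRing (MvPolynomial (Fin r) ℚ)
    (FractionRing (MvPolynomial (Fin r) ℚ)))

instance (r : ℕ) : CharZero (RatFun r) :=
  charZero_of_injective_algebraMap
    (IsFractionRing.injective (MvPolynomial (Fin r) ℚ) (RatFun r))

instance (r : ℕ) : IsScalarTower ℚ (MvPolynomial (Fin r) ℚ) (RatFun r) :=
  IsScalarTower.of_algebraMap_eq' (Subsingleton.elim _ _)

/-- A (rational) mould: a collection `(A_r)_{r ≥ 0}` with `A_r` a rational function of
`u₁, …, u_r`. -/
abbrev Mould : Type := ∀ r : ℕ, RatFun r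

/-- The space `ARI` of moulds with `A(∅) = 0`. -/
def ARI : Submodule ℚ Mould where
  carrier := {A | A 0 = 0}
  zero_mem' := rfl
  add_mem' := by
    intro A B hA hB
    simp only [Set.mem_ofPred_eq, Pi.add_apply] at *
    rw [hA, hB, add_zero]
  smul_mem' := by
    intro c A hA
    simp only [Set.mem_ofPred_eq, Pi.smul_apply] at *
    rw [hA]
    exact smul_zero (A := RatFun 0) c

/-- The value of a rational function at a point with coordinates in a field extension of `ℚ`,
computed from its reduced fraction. -/
def ratEval {L : Type} [Field L] [Algebra ℚ L] {m : ℕ} (f : RatFun m) (w : Fin m → L) : L :=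
  MvPolynomial.aeval w (IsFractionRing.num (MvPolynomial (Fin m) ℚ) f) /
    MvPolynomial.aeval w (IsFractionRing.den (MvPolynomial (Fin m) ℚ) f : MvPolynomial (Fin m) ℚ)

/-- The value of a rational function can be computed from any fraction whose denominator does not
vanish at the point. -/
theorem ratEval_eq {L : Type} [Field L] [Algebra ℚ L] {m : ℕ} (f : RatFun m) (w : Fin m → L)
    (p q : MvPolynomial (Fin m) ℚ) (hq : MvPolynomial.aeval w q ≠ 0)
    (h : f * algebraMap _ (RatFun m) q = algebraMap _ (RatFun m) p) :
    ratEval f w = MvPolynomial.aeval w p / MvPolynomial.aeval w q := by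
  set n := IsFractionRing.num (MvPolynomial (Fin m) ℚ) f with hn
  set d := (IsFractionRing.den (MvPolynomial (Fin m) ℚ) f : MvPolynomial (Fin m) ℚ) with hd
  have hd0 : algebraMap (MvPolynomial (Fin m) ℚ) (RatFun m) d ≠ 0 :=
    IsFractionRing.to_map_ne_zero_of_mem_nonZeroDivisors
      (IsFractionRing.den (MvPolynomial (Fin m) ℚ) f).2
  have hf : f * algebraMap _ (RatFun m) d = algebraMap _ (RatFun m) n := by
    have := IsFractionRing.mk'_num_den' (MvPolynomial (Fin m) ℚ) f
    rw [← hn, ← hd] at this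
    rw [← this, div_mul_cancel₀ _ hd0]
  have key : n * q = p * d := by
    apply IsFractionRing.injective (MvPolynomial (Fin m) ℚ) (RatFun m)
    rw [map_mul, map_mul, ← h, ← hf]
    ring
  have hdvd : d ∣ q := by
    have hrel := IsFractionRing.num_den_reduced (MvPolynomial (Fin m) ℚ) f
    exact (IsRelPrime.dvd_of_dvd_mul_left hrel.symm ⟨p, by rw [key, mul_comm]⟩)
  have hdw : MvPolynomial.aeval w d ≠ 0 := by
    obtain ⟨e, rfl⟩ := hdvd
    rw [map_mul] at hq
    exact left_ne_zero_of_mul hq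
  change MvPolynomial.aeval w n / MvPolynomial.aeval w d = _
  rw [div_eq_div_iff hdw hq, ← map_mul, ← map_mul, key]

/-- The value `A(w)` of a mould at a tuple `w = (w₁, …, w_m)`. -/
def evalAt {L : Type} [Field L] [Algebra ℚ L] (A : Mould) (w : List L) : L :=
  ratEval (A w.length) w.get

/-- The tuple of variables `(u₁, …, u_r)`. -/
def vars (r : ℕ) : List (RatFun r) :=
  List.ofFn fun i : Fin r => algebraMap (MvPolynomial (Fin r) ℚ) (RatFun r) (MvPolynomial.X i)

/-- `a⌈c`: for `w = abc` with `c` nonempty, the sum of the entries of `b` is added to the first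
entry of `c`, and `b` is removed. -/
def flexLeft {L : Type} [Field L] (a b c : List L) : List L :=
  a ++ (b.sum + c.headD 0) :: c.tail

/-- `a⌉c`: for `w = abc` with `a` nonempty, the sum of the entries of `b` is added to the last
entry of `a`, and `b` is removed. -/
def flexRight {L : Type} [Field L] (a b c : List L) : List L :=
  a.dropLast ++ (a.getLastD 0 + b.sum) :: c

/-- The operator `arit(B)` applied to `A`; here `(u₁, …, u_r)` is broken into
`a = (u₁, …, u_k)`, `b = (u_{k+1}, …, u_ℓ)`, `c = (u_{ℓ+1}, …, u_r)`, with `0 ≤ k < ℓ < r` in the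
first sum and `1 ≤ k < ℓ ≤ r` in the second. -/
def arit (B A : Mould) : Mould := fun r =>
  (∑ l ∈ Finset.range r, ∑ k ∈ Finset.range l,
    evalAt A (flexLeft ((vars r).take k) (((vars r).take l).drop k) ((vars r).drop l)) *
      evalAt B (((vars r).take l).drop k)) -
  ∑ l ∈ Finset.Icc 1 r, ∑ k ∈ Finset.Ico 1 l,
    evalAt A (flexRight ((vars r).take k) (((vars r).take l).drop k) ((vars r).drop l)) *
      evalAt B (((vars r).take l).drop k)

/-- The product `mu(A,B)(u₁, …, u_r) = ∑_{i=0}^r A(u₁, …, u_i) B(u_{i+1}, …, u_r)`. -/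
def mu (A B : Mould) : Mould := fun r =>
  ∑ i ∈ Finset.range (r + 1), evalAt A ((vars r).take i) * evalAt B ((vars r).drop i)

/-- The bracket `lu(A,B) = mu(A,B) - mu(B,A)`. -/
def lu (A B : Mould) : Mould := mu A B - mu B A

/-- The ari-bracket `ari(A,B) = arit(B)·A - arit(A)·B + lu(A,B)` on `ARI`. -/
def ari (A B : ARI) : ARI :=
  ⟨arit B.1 A.1 - arit A.1 B.1 + lu A.1 B.1, by
    change (arit B.1 A.1 - arit A.1 B.1 + lu A.1 B.1) 0 = 0
    simp [arit, lu, mu, vars, mul_comm]⟩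

/-! ### From Lie polynomials to moulds -/

/-- The linear map `ma` on `ℚ⟨C₁, C₂, …⟩`: the monomial
`C_{n₁+1} ⋯ C_{n_r+1}` is sent to `(-1)^(n₁+⋯+n_r) u₁^{n₁} ⋯ u_r^{n_r}` in depth `r` and to `0` in
the other depths. -/
def maPoly : PolyC →ₗ[ℚ] (∀ r : ℕ, MvPolynomial (Fin r) ℚ) :=
  (FreeAlgebra.basisFreeMonoid ℚ ℕ).constr ℚ fun w r =>
    if w.length = r then
      (-1) ^ w.toList.sum * ∏ i : Fin r, MvPolynomial.X i ^ w.toList.getD i 0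
    else 0

/-- `ma(F)` for a Lie polynomial `F`, written as a polynomial in the `Cᵢ`. -/
def ma : LieAB →ₗ[ℚ] (∀ r : ℕ, MvPolynomial (Fin r) ℚ) := maPoly ∘ₗ toPolyC

/-- `Δ_r = u₁ ⋯ u_r (u₁ + ⋯ + u_r)`. -/
def Delta (r : ℕ) : MvPolynomial (Fin r) ℚ :=
  (∏ i : Fin r, MvPolynomial.X i) * ∑ i : Fin r, MvPolynomial.X i

/-- The mould `ma(F)(u₁, …, u_r) / Δ_r` in depth `r ≥ 1`, with value `0` in depth `0`. -/
def Da : LieAB →ₗ[ℚ] ARI where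
  toFun F :=
    ⟨fun r => if r = 0 then 0 else
      algebraMap _ (RatFun r) (ma F r) / algebraMap _ (RatFun r) (Delta r), if_pos rfl⟩
  map_add' F G := by
    apply Subtype.ext
    funext r
    by_cases hr : r = 0
    · simp [hr]
    · simp [hr, add_div]
  map_smul' c F := by
    apply Subtype.ext
    funext r
    by_cases hr : r = 0
    · simp [hr]
    · have h : algebraMap (MvPolynomial (Fin r) ℚ) (RatFun r) (c • ma F r) =
          c • algebraMap (MvPolynomial (Fin r) ℚ) (RatFun r) (ma F r) := by
        rw [Algebra.smul_def, Algebra.smul_def, map_mul, ← IsScalarTower.algebraMap_apply]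
      simp only [map_smul, Pi.smul_apply, hr, if_false, h, smul_div_assoc]
      simp [hr]

/-- The linear map `Ψ : Der⁰ Lie[a,b] → ARI`, `Ψ(D)_r = ma(D(a)) / Δ_r`. -/
def Psi : Der0 →ₗ[ℚ] ARI where
  toFun D := Da (D.1 genA)
  map_add' D E := by
    change Da ((D.1 + E.1) genA) = _
    rw [LieDerivation.add_apply, map_add]
  map_smul' c D := by
    change Da ((c • D.1) genA) = _
    rw [LieDerivation.smul_apply, map_smul, RingHom.id_apply]

end

end EllipticMould

/-!
Divide the mould `ma(F)` by `u₁ ⋯ u_r` only. The resulting map `F ↦ lieMould F` turns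
concatenation of noncommutative polynomials into `mu` and `ad(a)` into minus the multiplication by
`u₁ + ⋯ + u_r`, called `weight`, which is a derivation commuting with `arit(B)`. The mould of `b`
becomes the mould `T` with `weight T = 1` in depth one, and `arat(B) = ad(B) - arit(B)` is a
derivation of `mu` killing `weight T`.

Given `D` in `Der⁰`, the mould `B = Ψ(D)` is characterized by `weight B = lieMould (D a)`. Applying
`lieMould` to `D [a, b] = 0` gives `weight (lieMould (D b)) = [weight B, T] = weight (arat(B) T)`.
Hence `lieMould ∘ D` and `arat(B) ∘ lieMould` agree on `b`, and by the derivation property they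
agree, up to a multiple of `weight B`, on all of `Lie[a, b]`. Evaluating `[D₁, D₂]` on `a` gives the
morphism property after division by `u₁ + ⋯ + u_r`. If `Ψ(D) = 0`, then `B = 0` and `lieMould`
vanishes on both `D a` and `D b`, which are then zero because `Lie[C₁, C₂, …]` embeds into
`ℚ⟨C₁, C₂, …⟩`.
-/

namespace EllipticMould

attribute [local instance 100] LieRing.ofAssociativeRing

open Finset

/-! ### Embedding of a free Lie algebra into the free associative algebra -/

section FreeLie

variable {K X : Type*} [CommRing K]

theorem lieSpan_range_of :
    LieSubalgebra.lieSpan K (FreeLieAlgebra K X) (Set.range (FreeLieAlgebra.of K)) = ⊤ := by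
  set S := LieSubalgebra.lieSpan K (FreeLieAlgebra K X) (Set.range (FreeLieAlgebra.of K))
  let r : FreeLieAlgebra K X →ₗ⁅K⁆ S := FreeLieAlgebra.lift K fun x =>
    ⟨FreeLieAlgebra.of K x, LieSubalgebra.subset_lieSpan ⟨x, rfl⟩⟩
  have hr : S.incl.comp r = LieHom.id := FreeLieAlgebra.hom_ext fun x => by simp [r]
  have hF (F) : (r F : FreeLieAlgebra K X) = F := DFunLike.congr_fun hr F
  exact eq_top_iff.2 fun F _ => hF F ▸ (r F).2

@[elab_as_elim]
theorem freeLie_induction {p : FreeLieAlgebra K X → Prop}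
    (of : ∀ x, p (FreeLieAlgebra.of K x)) (zero : p 0)
    (add : ∀ F G, p F → p G → p (F + G)) (smul : ∀ (c : K) F, p F → p (c • F))
    (lie : ∀ F G, p F → p G → p ⁅F, G⁆) (F : FreeLieAlgebra K X) : p F := by
  have hF : F ∈ LieSubalgebra.lieSpan K (FreeLieAlgebra K X) (Set.range (FreeLieAlgebra.of K)) :=
    lieSpan_range_of (K := K) (X := X) ▸ LieSubalgebra.mem_top F
  induction hF using LieSubalgebra.lieSpan_induction with
  | mem _ h => obtain ⟨x, rfl⟩ := h; exact of x
  | zero => exact zero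
  | add _ _ _ _ h h' => exact add _ _ h h'
  | smul c _ _ h => exact smul c _ h
  | lie _ _ _ _ h h' => exact lie _ _ h h'

/-- The endomorphism `(l, c) ↦ (d l + c v, 0)` of `L × K`: the matrix form of the affine
transformation of `L` with linear part `d` and translation part `v`. -/
def affineEnd {L : Type*} [AddCommGroup L] [Module K L] (d : Module.End K L) (v : L) :
    Module.End K (L × K) :=
  LinearMap.inl K L K ∘ₗ d.coprod (LinearMap.toSpanSingleton K L v)

theorem lie_affineEnd {L : Type*} [AddCommGroup L] [Module K L] (d e : Module.End K L) (v w : L) :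
    ⁅affineEnd d v, affineEnd e w⁆ = affineEnd ⁅d, e⁆ (d w - e v) := by
  ext <;> simp [affineEnd, Ring.lie_def]

variable (K X) in
/-- The representation of a free Lie algebra `L` on `L × K` that encodes its Euler derivation `E`:
`F` acts by `(G, c) ↦ (⁅F, G⁆ + c E F, 0)`, see `eulerRep_eq_affineEnd`. -/
noncomputable def eulerRep :
    FreeLieAlgebra K X →ₗ⁅K⁆ Module.End K (FreeLieAlgebra K X × K) :=
  FreeLieAlgebra.lift K fun x =>
    affineEnd (LieAlgebra.ad K _ (FreeLieAlgebra.of K x)) (FreeLieAlgebra.of K x)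

theorem eulerRep_eq_affineEnd (F : FreeLieAlgebra K X) :
    eulerRep K X F = affineEnd (LieAlgebra.ad K _ F) (eulerRep K X F (0, 1)).1 := by
  suffices h : ∃ v, eulerRep K X F = affineEnd (LieAlgebra.ad K _ F) v by
    obtain ⟨v, hv⟩ := h
    simpa [hv] using by simp [affineEnd]
  induction F using freeLie_induction with
  | of x => exact ⟨_, FreeLieAlgebra.lift_of_apply _ x⟩
  | zero => exact ⟨0, by ext <;> simp [affineEnd]⟩
  | add F G hF hG =>
    obtain ⟨v, hv⟩ := hF
    obtain ⟨w, hw⟩ := hG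
    exact ⟨v + w, by rw [map_add, hv, hw]; ext <;> simp [affineEnd]⟩
  | smul c F hF =>
    obtain ⟨v, hv⟩ := hF
    exact ⟨c • v, by rw [map_smul, hv]; ext <;> simp [affineEnd]⟩
  | lie F G hF hG =>
    obtain ⟨v, hv⟩ := hF
    obtain ⟨w, hw⟩ := hG
    exact ⟨_, by rw [LieHom.map_lie, hv, hw, lie_affineEnd, LieHom.map_lie]⟩

variable (K X) in
/-- The Euler derivation of a free Lie algebra, which fixes the generators and hence multiplies a
Lie polynomial of degree `n` by `n`. -/
noncomputable def eulerDerivation :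
    LieDerivation K (FreeLieAlgebra K X) (FreeLieAlgebra K X) where
  toFun F := (eulerRep K X F (0, 1)).1
  map_add' F G := by simp
  map_smul' c F := by simp
  leibniz' F G := by
    change (eulerRep K X ⁅F, G⁆ (0, 1)).1 =
      ⁅F, (eulerRep K X G (0, 1)).1⁆ - ⁅G, (eulerRep K X F (0, 1)).1⁆
    rw [LieHom.map_lie, eulerRep_eq_affineEnd F, eulerRep_eq_affineEnd G, lie_affineEnd]
    simp [affineEnd]

theorem eulerDerivation_of (x : X) :
    eulerDerivation K X (FreeLieAlgebra.of K x) = FreeLieAlgebra.of K x := by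
  change (eulerRep K X (FreeLieAlgebra.of K x) (0, 1)).1 = _
  simp [eulerRep, affineEnd]

theorem lie_mem_eigenspace {L : Type*} [LieRing L] [LieAlgebra K L] (D : LieDerivation K L L)
    {μ ν : K} {F G : L} (hF : F ∈ Module.End.eigenspace D.toLinearMap μ)
    (hG : G ∈ Module.End.eigenspace D.toLinearMap ν) :
    ⁅F, G⁆ ∈ Module.End.eigenspace D.toLinearMap (μ + ν) := by
  rw [Module.End.mem_eigenspace_iff, LieDerivation.coeFn_coe] at *
  rw [D.apply_lie_eq_add, hF, hG, lie_smul, smul_lie, add_smul, add_comm]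

theorem iSup_eigenspace_eulerDerivation :
    ⨆ n : ℕ, Module.End.eigenspace (eulerDerivation K X).toLinearMap (n + 1 : K) = ⊤ := by
  set V := fun n : ℕ => Module.End.eigenspace (eulerDerivation K X).toLinearMap (n + 1 : K)
  have lie_mem : ∀ F G, F ∈ ⨆ n, V n → G ∈ ⨆ n, V n → ⁅F, G⁆ ∈ ⨆ n, V n := by
    intro F G hF hG
    induction hF using Submodule.iSup_induction' with
    | zero => simp
    | add F F' _ _ h h' => rw [add_lie]; exact add_mem h h'
    | mem m F hF =>
      induction hG using Submodule.iSup_induction' with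
      | zero => simp
      | add G G' _ _ h h' => rw [lie_add]; exact add_mem h h'
      | mem n G hG =>
        have degree : (m + 1 + (n + 1) : K) = (m + n + 1 : ℕ) + 1 := by push_cast; ring
        refine Submodule.mem_iSup_of_mem (m + n + 1) ?_
        simpa only [V, ← degree] using lie_mem_eigenspace _ hF hG
  refine eq_top_iff.2 fun F _ => ?_
  induction F using freeLie_induction with
  | of x =>
    refine Submodule.mem_iSup_of_mem 0 (Module.End.mem_eigenspace_iff.2 ?_)
    simpa using eulerDerivation_of x
  | zero => exact zero_mem _
  | add F G hF hG => exact add_mem (hF trivial) (hG trivial)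
  | smul c F hF => exact Submodule.smul_mem _ c (hF trivial)
  | lie F G hF hG => exact lie_mem F G (hF trivial) (hG trivial)

end FreeLie

section FreeLieField

variable {K X : Type*} [Field K] [CharZero K]

theorem eulerDerivation_injective : Function.Injective (eulerDerivation K X) := by
  refine (injective_iff_map_eq_zero _).2 fun F hF => ?_
  have disjoint := (Module.End.eigenspaces_iSupIndep (eulerDerivation K X).toLinearMap) 0
  refine Submodule.disjoint_def.1 disjoint F (by simpa using hF) ?_
  have le : ⨆ n : ℕ, Module.End.eigenspace (eulerDerivation K X).toLinearMap (n + 1 : K) ≤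
      ⨆ μ, ⨆ (_ : μ ≠ 0), Module.End.eigenspace (eulerDerivation K X).toLinearMap μ :=
    iSup_le fun n => le_iSup₂_of_le (n + 1 : K) (Nat.cast_add_one_ne_zero n) le_rfl
  exact le (iSup_eigenspace_eulerDerivation (K := K) (X := X) ▸ trivial)

-- An associative action of `FreeAlgebra K X` restricts to `eulerRep`, so `F` can be read off up to
-- the injective `E`.
theorem lift_ι_injective :
    Function.Injective (FreeLieAlgebra.lift K (FreeAlgebra.ι K) :
      FreeLieAlgebra K X →ₗ⁅K⁆ FreeAlgebra K X) := by
  let ρ : FreeAlgebra K X →ₐ[K] Module.End K (FreeLieAlgebra K X × K) :=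
    FreeAlgebra.lift K fun x => eulerRep K X (FreeLieAlgebra.of K x)
  have hρ : (AlgHom.toLieHom ρ).comp (FreeLieAlgebra.lift K (FreeAlgebra.ι K)) = eulerRep K X :=
    FreeLieAlgebra.hom_ext fun x => by simp [ρ]
  refine (injective_iff_map_eq_zero _).2 fun F hF => eulerDerivation_injective ?_
  have h : eulerRep K X F = 0 := by
    rw [← hρ, LieHom.comp_apply, hF, map_zero]
  exact (congrArg (fun T => (T (0, 1)).1) h).trans (map_zero (eulerDerivation K X)).symm

end FreeLieField

theorem assocC_injective : Function.Injective assocC :=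
  lift_ι_injective

theorem toPolyC_eq_zero {F : LieAB} (hc : coeffA F = 0) (hF : toPolyC F = 0) : F = 0 := by
  obtain ⟨P, hP⟩ := exists_eq_expandC F
  have hP0 : P = 0 := assocC_injective <| by rw [← toPolyC_eq (coeffA F), ← hP, hF, map_zero]
  rw [hP, hc, hP0, map_zero, zero_smul, add_zero]

@[elab_as_elim]
theorem lieAB_induction {p : LieAB → Prop} (genA : p genA) (genB : p genB)
    (add : ∀ F G, p F → p G → p (F + G)) (smul : ∀ (c : ℚ) F, p F → p (c • F))
    (lie : ∀ F G, p F → p G → p ⁅F, G⁆) (F : LieAB) : p F := by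
  refine freeLie_induction (fun i => ?_) (by simpa using smul 0 _ genA) add smul lie F
  fin_cases i
  exacts [genA, genB]

/-! ### Sums over the factorizations of a word -/

section SplitSum

variable {α M R : Type*} [AddCommMonoid M] [NonUnitalNonAssocSemiring R]

/-- The sum of `φ a b` over all factorizations `w = a ++ b`. -/
def splitSum (φ : List α → List α → M) (w : List α) : M :=
  ∑ i ∈ range (w.length + 1), φ (w.take i) (w.drop i)

theorem splitSum_nil (φ : List α → List α → M) : splitSum φ [] = φ [] [] := by
  simp [splitSum]

theorem splitSum_cons (φ : List α → List α → M) (x : α) (w : List α) :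
    splitSum φ (x :: w) = φ [] (x :: w) + splitSum (fun a b => φ (x :: a) b) w := by
  rw [splitSum, List.length_cons, sum_range_succ', add_comm]
  simp [splitSum]

theorem splitSum_append_cons (φ : List α → List α → M) (a : List α) (x : α) (c : List α) :
    splitSum φ (a ++ x :: c) = splitSum (fun a₁ a₂ => φ a₁ (a₂ ++ x :: c)) a +
      splitSum (fun c₁ c₂ => φ (a ++ x :: c₁) c₂) c := by
  induction a generalizing φ with
  | nil => simp [splitSum_nil, splitSum_cons]
  | cons y a ih => simp [splitSum_cons, ih, add_assoc]

theorem splitSum_congr {φ ψ : List α → List α → M} {w : List α}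
    (h : ∀ a b, a ++ b = w → φ a b = ψ a b) : splitSum φ w = splitSum ψ w :=
  sum_congr rfl fun _ _ => h _ _ (List.take_append_drop _ _)

theorem splitSum_eq_nil_left {φ : List α → List α → M} (h : ∀ a b, a ≠ [] → φ a b = 0)
    (w : List α) : splitSum φ w = φ [] w := by
  cases w with
  | nil => exact splitSum_nil φ
  | cons x w => rw [splitSum_cons, splitSum, sum_eq_zero (by simp [h]), add_zero]

theorem splitSum_eq_nil_right {φ : List α → List α → M} (h : ∀ a b, b ≠ [] → φ a b = 0)
    (w : List α) : splitSum φ w = φ w [] := by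
  induction w generalizing φ with
  | nil => exact splitSum_nil φ
  | cons x w ih => rw [splitSum_cons, h _ _ (List.cons_ne_nil x w), zero_add, ih fun a b => h _ b]

theorem splitSum_add (φ ψ : List α → List α → M) (w : List α) :
    splitSum (fun a b => φ a b + ψ a b) w = splitSum φ w + splitSum ψ w :=
  sum_add_distrib

theorem splitSum_comm {β : Type*} (φ : List α → List α → List β → List β → M) (v : List α)
    (w : List β) : splitSum (fun a b => splitSum (fun c d => φ a b c d) w) v =
      splitSum (fun c d => splitSum (fun a b => φ a b c d) v) w :=
  sum_comm

theorem splitSum_assoc (φ : List α → List α → List α → M) (w : List α) :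
    splitSum (fun t c => splitSum (fun a b => φ a b c) t) w =
      splitSum (fun a t => splitSum (fun b c => φ a b c) t) w := by
  induction w generalizing φ with
  | nil => simp [splitSum_nil]
  | cons x w ih => simp only [splitSum_cons, splitSum_nil, splitSum_add, ih, add_assoc]

theorem smul_splitSum {k : Type*} [DistribSMul k M] (c : k) (φ : List α → List α → M)
    (w : List α) : c • splitSum φ w = splitSum (fun a b => c • φ a b) w :=
  smul_sum

theorem mul_splitSum (r : R) (φ : List α → List α → R) (w : List α) :
    r * splitSum φ w = splitSum (fun a b => r * φ a b) w :=
  mul_sum _ _ _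

theorem splitSum_mul (r : R) (φ : List α → List α → R) (w : List α) :
    splitSum φ w * r = splitSum (fun a b => φ a b * r) w :=
  sum_mul _ _ _

end SplitSum

/-! ### Moulds as functions on words -/

/-- Moulds evaluated on the words over an alphabet `S`: the family `(A_r)` is encoded by the single
function `w ↦ A_r(w)` on words `w` of arbitrary length `r`. Taking for `S` a semigroup of
arguments at which no denominator vanishes makes all operations on moulds total. -/
def WordMould (S R : Type*) : Type _ := List S → R

namespace WordMould

@[ext] theorem ext {S R : Type*} {f g : WordMould S R} (h : ∀ w, f w = g w) : f = g := funext h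

section Ring

variable {S R k : Type*} [Ring R] [CommSemiring k] [Algebra k R]

instance : AddCommGroup (WordMould S R) := inferInstanceAs (AddCommGroup (List S → R))

instance : Module k (WordMould S R) := inferInstanceAs (Module k (List S → R))

/-- The mould product `mu`. -/
instance : Mul (WordMould S R) := ⟨fun f g => splitSum fun a b => f a * g b⟩

instance : One (WordMould S R) := ⟨fun | [] => 1 | _ :: _ => 0⟩

@[simp] protected theorem zero_apply (w : List S) : (0 : WordMould S R) w = 0 := rfl

@[simp] protected theorem add_apply (f g : WordMould S R) (w : List S) :
    (f + g) w = f w + g w := rfl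

@[simp] protected theorem neg_apply (f : WordMould S R) (w : List S) : (-f) w = -f w := rfl

@[simp] protected theorem sub_apply (f g : WordMould S R) (w : List S) :
    (f - g) w = f w - g w := rfl

@[simp] protected theorem smul_apply (c : k) (f : WordMould S R) (w : List S) :
    (c • f) w = c • f w := rfl

@[simp] theorem one_nil : (1 : WordMould S R) [] = 1 := rfl

@[simp] theorem one_cons (x : S) (w : List S) : (1 : WordMould S R) (x :: w) = 0 := rfl

theorem mul_apply (f g : WordMould S R) (w : List S) :
    (f * g) w = splitSum (fun a b => f a * g b) w := rfl

instance : Ring (WordMould S R) where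
  __ := (inferInstance : AddCommGroup (WordMould S R))
  left_distrib f g h := by ext w; simp only [mul_apply, WordMould.add_apply, mul_add, splitSum_add]
  right_distrib f g h := by ext w; simp only [mul_apply, WordMould.add_apply, add_mul, splitSum_add]
  zero_mul f := by ext w; simp [mul_apply, splitSum]
  mul_zero f := by ext w; simp [mul_apply, splitSum]
  mul_assoc f g h := by
    ext w
    simp only [mul_apply, splitSum_mul, mul_splitSum, mul_assoc]
    exact splitSum_assoc (fun a b c => f a * (g b * h c)) w
  one_mul f := by
    ext w
    rw [mul_apply, splitSum_eq_nil_left, one_nil, one_mul]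
    rintro (_ | ⟨x, a⟩) b h
    exacts [absurd rfl h, zero_mul _]
  mul_one f := by
    ext w
    rw [mul_apply, splitSum_eq_nil_right, one_nil, mul_one]
    rintro a (_ | ⟨x, b⟩) h
    exacts [absurd rfl h, mul_zero _]

instance : Algebra k (WordMould S R) :=
  Algebra.ofModule
    (fun c f g => by
      ext w
      simp only [mul_apply, WordMould.smul_apply, smul_mul_assoc, smul_splitSum])
    (fun c f g => by
      ext w
      simp only [mul_apply, WordMould.smul_apply, mul_smul_comm, smul_splitSum])

theorem mul_nil (f g : WordMould S R) : (f * g) [] = f [] * g [] :=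
  splitSum_nil _

/-- The mould concentrated in depth one with given values there. -/
def single (f : S → R) : WordMould S R
  | [x] => f x
  | _ => 0

theorem single_nil (f : S → R) : single f [] = 0 := by
  simp [single]

theorem single_mul_nil (f : S → R) (g : WordMould S R) : (single f * g) [] = 0 := by
  rw [mul_nil, single_nil, zero_mul]

theorem single_mul_cons (f : S → R) (g : WordMould S R) (x : S) (w : List S) :
    (single f * g) (x :: w) = f x * g w := by
  rw [mul_apply, splitSum_cons, splitSum_eq_nil_left]
  · simp [single]
  · rintro (_ | ⟨y, a⟩) b h
    exacts [absurd rfl h, zero_mul _]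

end Ring

section Arit

variable {S R : Type*} [CommRing R]

/-- The value of a mould at a word, as a linear form. -/
def coeff (w : List S) : WordMould S R →ₗ[R] R := LinearMap.proj w

@[simp] theorem coeff_apply (w : List S) (f : WordMould S R) : coeff w f = f w := rfl

/-- The operation `A ↦ ∑ τ(a, b, c)(A) B(b)`, the sum being over the factorizations `w = abc`; both
halves of `arit(B)` are of this form. -/
def contract (τ : List S → List S → List S → WordMould S R →ₗ[R] R) (B : WordMould S R) :
    WordMould S R →ₗ[R] WordMould S R where
  toFun A := splitSum fun t c => splitSum (fun a b => τ a b c A * B b) t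
  map_add' A A' := by
    ext w
    simp only [map_add, add_mul, splitSum_add]
    rfl
  map_smul' r A := by
    ext w
    simp only [map_smul, smul_eq_mul, mul_assoc, ← mul_splitSum]
    rfl

theorem contract_apply (τ : List S → List S → List S → WordMould S R →ₗ[R] R)
    (A B : WordMould S R) (w : List S) :
    contract τ B A w = splitSum (fun t c => splitSum (fun a b => τ a b c A * B b) t) w := rfl

theorem contract_mul {τ : List S → List S → List S → WordMould S R →ₗ[R] R}
    (hτ : ∀ a b c f g, τ a b c (f * g) = splitSum (fun c₁ c₂ => τ a b c₁ f * g c₂) c +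
      splitSum (fun a₁ a₂ => f a₁ * τ a₂ b c g) a) (B f g : WordMould S R) :
    contract τ B (f * g) = contract τ B f * g + f * contract τ B g := by
  ext w
  simp only [contract_apply, WordMould.add_apply, mul_apply, hτ, add_mul, splitSum_add,
    splitSum_mul, mul_splitSum]
  congr 1
  · rw [splitSum_assoc fun t c d => splitSum (fun a b => τ a b c f * B b * g d) t]
    refine splitSum_congr fun t s _ => (splitSum_comm _ t s).trans ?_
    simp only [mul_right_comm]
  · rw [← splitSum_assoc fun d t c => splitSum (fun a b => f d * (τ a b c g * B b)) t]
    refine splitSum_congr fun t c _ => ?_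
    rw [← splitSum_assoc fun d a b => f d * (τ a b c g * B b)]
    simp only [mul_assoc]

variable [Add S]

/-- `A(a⌈c)`, where `a⌈c` adds the entries of `b` to the first letter of `c`; it is `0` when `c` is
empty. -/
def evalLeft (a b : List S) : List S → WordMould S R →ₗ[R] R
  | [] => 0
  | z :: c => coeff (a ++ b.foldr (· + ·) z :: c)

/-- `A(a⌉c)`, where `a⌉c` adds the entries of `b` to the last letter of `a`; it is `0` when `a` is
empty. -/
def evalRight (a b c : List S) : WordMould S R →ₗ[R] R :=
  a.getLast?.elim 0 fun x => coeff (a.dropLast ++ b.foldl (· + ·) x :: c)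

theorem evalRight_nil (b c : List S) : evalRight (R := R) [] b c = 0 := rfl

theorem evalRight_concat (a : List S) (x : S) (b c : List S) :
    evalRight (R := R) (a ++ [x]) b c = coeff (a ++ b.foldl (· + ·) x :: c) := by
  simp [evalRight]

theorem evalLeft_mul (a b c : List S) (f g : WordMould S R) :
    evalLeft a b c (f * g) = splitSum (fun c₁ c₂ => evalLeft a b c₁ f * g c₂) c +
      splitSum (fun a₁ a₂ => f a₁ * evalLeft a₂ b c g) a := by
  cases c with
  | nil => simp [evalLeft, splitSum]
  | cons z c => simp [evalLeft, mul_apply, splitSum_append_cons, splitSum_cons, add_comm]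

theorem evalRight_mul (a b c : List S) (f g : WordMould S R) :
    evalRight a b c (f * g) = splitSum (fun c₁ c₂ => evalRight a b c₁ f * g c₂) c +
      splitSum (fun a₁ a₂ => f a₁ * evalRight a₂ b c g) a := by
  obtain rfl | ⟨a, x, rfl⟩ := a.eq_nil_or_concat'
  · simp [evalRight_nil, splitSum]
  · simp [evalRight_concat, evalRight_nil, mul_apply, splitSum_append_cons, splitSum_nil, add_comm]

/-- The operator `arit(B)`. -/
def arit (B : WordMould S R) : WordMould S R →ₗ[R] WordMould S R :=
  contract evalLeft B - contract evalRight B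

theorem arit_mul (B f g : WordMould S R) : arit B (f * g) = arit B f * g + f * arit B g := by
  simp only [arit, LinearMap.sub_apply, contract_mul evalLeft_mul, contract_mul evalRight_mul]
  noncomm_ring

theorem evalLeft_single (a b c : List S) :
    evalLeft a b c (single 1 : WordMould S R) = if a = [] then single 1 c else 0 := by
  rcases a with _ | ⟨x, _ | ⟨y, a⟩⟩ <;> rcases c with _ | ⟨z, _ | ⟨z', c⟩⟩ <;>
    simp [evalLeft, single]

theorem evalRight_single (a b c : List S) :
    evalRight a b c (single 1 : WordMould S R) = if c = [] then single 1 a else 0 := by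
  obtain rfl | ⟨a, x, rfl⟩ := a.eq_nil_or_concat'
  · simp [evalRight_nil, single]
  · rw [evalRight_concat]
    rcases a with _ | ⟨y, _ | ⟨z, a⟩⟩ <;> cases c <;> simp [single]

theorem contract_evalLeft_single (B : WordMould S R) :
    contract evalLeft B (single 1) = B * single 1 := by
  ext w
  rw [contract_apply, mul_apply]
  refine splitSum_congr fun t c _ => ?_
  rw [splitSum_eq_nil_left, evalLeft_single, if_pos rfl, mul_comm]
  intro a b ha
  rw [evalLeft_single, if_neg ha, zero_mul]

theorem contract_evalRight_single (B : WordMould S R) :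
    contract evalRight B (single 1) = single 1 * B := by
  ext w
  rw [contract_apply, mul_apply, splitSum_assoc fun a b c => evalRight a b c (single 1) * B b]
  refine splitSum_congr fun a t _ => ?_
  rw [splitSum_eq_nil_right, evalRight_single, if_pos rfl]
  intro b c hc
  rw [evalRight_single, if_neg hc, zero_mul]

/-- The derivation `arat(B)` of the algebra of moulds, `A ↦ lu(B, A) - arit(B) A`. -/
def arat (B : WordMould S R) : WordMould S R →ₗ[R] WordMould S R :=
  LinearMap.mulLeft R B - LinearMap.mulRight R B - arit B

theorem arat_apply (B A : WordMould S R) : arat B A = ⁅B, A⁆ - arit B A := rfl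

theorem arat_zero (A : WordMould S R) : arat 0 A = 0 := by
  ext w
  simp [arat, arit, contract_apply, splitSum]

theorem arat_single_one (B : WordMould S R) : arat B (single 1) = 0 := by
  rw [arat_apply, arit, LinearMap.sub_apply, contract_evalLeft_single, contract_evalRight_single,
    Ring.lie_def, sub_self]

theorem arat_lie (B f g : WordMould S R) : arat B ⁅f, g⁆ = ⁅arat B f, g⁆ + ⁅f, arat B g⁆ := by
  simp only [arat_apply, Ring.lie_def, map_sub, arit_mul]
  noncomm_ring

/-- The ari-bracket. -/
def ari (A B : WordMould S R) : WordMould S R := arit B A - arit A B + ⁅A, B⁆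

theorem arit_nil (A B : WordMould S R) : arit B A [] = 0 := by
  simp [arit, contract_apply, splitSum_nil, evalLeft, evalRight]

end Arit

section Weight

variable {S R : Type*} [CommRing R] [Add S] (σ : S →ₙ+ R)

theorem map_foldr_add (b : List S) (z : S) :
    σ (b.foldr (· + ·) z) = (b.map σ).sum + σ z := by
  induction b with
  | nil => simp
  | cons x b ih => simp [ih, add_assoc]

theorem map_foldl_add (b : List S) (x : S) :
    σ (b.foldl (· + ·) x) = σ x + (b.map σ).sum := by
  induction b generalizing x with
  | nil => simp
  | cons y b ih => simp [ih, add_assoc]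

/-- Multiplication by `u₁ + ⋯ + u_r`. -/
def weight : WordMould S R →ₗ[R] WordMould S R where
  toFun f w := (w.map σ).sum * f w
  map_add' f g := by ext w; exact mul_add _ _ _
  map_smul' r f := by ext w; exact mul_left_comm _ _ _

theorem weight_apply (f : WordMould S R) (w : List S) : weight σ f w = (w.map σ).sum * f w := rfl

theorem weight_mul (f g : WordMould S R) :
    weight σ (f * g) = weight σ f * g + f * weight σ g := by
  ext w
  simp only [weight_apply, mul_apply, WordMould.add_apply, mul_splitSum, ← splitSum_add]
  refine splitSum_congr fun a b h => ?_
  rw [← h, List.map_append, List.sum_append]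
  ring

theorem weight_one : weight σ (1 : WordMould S R) = 0 := by
  ext w
  cases w <;> simp [weight_apply]

theorem weight_lie (f g : WordMould S R) :
    weight σ ⁅f, g⁆ = ⁅weight σ f, g⁆ + ⁅f, weight σ g⁆ := by
  simp only [Ring.lie_def, map_sub, weight_mul]
  noncomm_ring

theorem evalLeft_weight (a b c : List S) (f : WordMould S R) :
    evalLeft a b c (weight σ f) = ((a ++ b ++ c).map σ).sum * evalLeft a b c f := by
  cases c with
  | nil => simp [evalLeft]
  | cons z c => simp [evalLeft, weight_apply, map_foldr_add, add_assoc]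

theorem evalRight_weight (a b c : List S) (f : WordMould S R) :
    evalRight a b c (weight σ f) = ((a ++ b ++ c).map σ).sum * evalRight a b c f := by
  obtain rfl | ⟨a, x, rfl⟩ := a.eq_nil_or_concat'
  · simp [evalRight_nil]
  · simp [evalRight_concat, weight_apply, map_foldl_add, add_assoc]

theorem contract_weight {τ : List S → List S → List S → WordMould S R →ₗ[R] R}
    (hτ : ∀ a b c f, τ a b c (weight σ f) = ((a ++ b ++ c).map σ).sum * τ a b c f)
    (B f : WordMould S R) : contract τ B (weight σ f) = weight σ (contract τ B f) := by
  ext w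
  simp only [weight_apply, contract_apply, hτ, mul_splitSum]
  refine splitSum_congr fun t c h => splitSum_congr fun a b h' => ?_
  rw [h', h, mul_assoc]

theorem arit_weight (B f : WordMould S R) : arit B (weight σ f) = weight σ (arit B f) := by
  simp only [arit, LinearMap.sub_apply, contract_weight σ (evalLeft_weight σ),
    contract_weight σ (evalRight_weight σ), map_sub]

theorem weight_arat (B f : WordMould S R) :
    weight σ (arat B f) = arat B (weight σ f) + ⁅weight σ B, f⁆ := by
  simp only [arat_apply, map_sub, weight_lie, arit_weight]
  abel

variable {σ}

theorem exists_map_eq_sum {w : List S} (hw : w ≠ []) : ∃ x, σ x = (w.map σ).sum := by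
  obtain ⟨x, w, rfl⟩ := List.exists_cons_of_ne_nil hw
  exact ⟨w.foldl (· + ·) x, by simp [map_foldl_add]⟩

theorem eq_of_weight_eq [NoZeroDivisors R] (hσ : ∀ x, σ x ≠ 0) {f g : WordMould S R}
    (h_nil : f [] = g []) (h : weight σ f = weight σ g) : f = g := by
  ext w
  obtain rfl | hw := eq_or_ne w []
  · exact h_nil
  · obtain ⟨x, hx⟩ := exists_map_eq_sum (σ := σ) hw
    exact mul_left_cancel₀ (hx ▸ hσ x) (congrFun h w)

end Weight

end WordMould

/-! ### The action of `Der⁰` on moulds -/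

section Action

open WordMould

theorem actC_eq (F : LieAB) : actC F = LinearMap.mulLeft ℚ (toPolyC F) + coeffA F • shiftC := by
  obtain ⟨P, hP⟩ := exists_eq_expandC F
  rw [show toPolyC F = assocC P from hP ▸ toPolyC_eq (coeffA F) P]
  conv_lhs => rw [hP, map_add, map_smul, actC_genA, actC_expandC, add_comm]

theorem toPolyC_lie (F G : LieAB) : toPolyC ⁅F, G⁆ = ⁅toPolyC F, toPolyC G⁆ +
    coeffA F • shiftC (toPolyC G) - coeffA G • shiftC (toPolyC F) := by
  have h : toPolyC ⁅F, G⁆ = actC F (toPolyC G) - actC G (toPolyC F) := by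
    change actC ⁅F, G⁆ 1 = _
    rw [LieHom.map_lie]
    rfl
  rw [h, actC_eq, actC_eq]
  simp only [LinearMap.add_apply, LinearMap.mulLeft_apply, LinearMap.smul_apply, Ring.lie_def]
  abel

theorem toPolyC_genA : toPolyC genA = 0 := by
  simpa using toPolyC_eq 1 0

theorem toPolyC_genB : toPolyC genB = FreeAlgebra.ι ℚ 0 := by
  change actC genB 1 = _
  rw [actC_genB, LinearMap.mulLeft_apply, mul_one]

variable {S L : Type*} [Add S] [Field L] [CharZero L] (σ : S →ₙ+ L)

/-- The mould `ma(P)(u₁, …, u_r) / (u₁ ⋯ u_r)` of a polynomial `P`. With this normalization, the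
letter `C_{n+1}` is sent to the depth-one mould `(-u₁)^n / u₁`. -/
noncomputable def polyMould : PolyC →ₐ[ℚ] WordMould S L :=
  FreeAlgebra.lift ℚ fun n => single fun x => (-σ x) ^ n / σ x

theorem polyMould_ι (n : ℕ) :
    polyMould σ (FreeAlgebra.ι ℚ n) = single fun x => (-σ x) ^ n / σ x :=
  FreeAlgebra.lift_ι_apply _ n

theorem polyMould_shiftC (P : PolyC) : polyMould σ (shiftC P) = -weight σ (polyMould σ P) := by
  induction P using FreeAlgebra.induction with
  | grade0 c =>
    rw [Algebra.algebraMap_eq_smul_one, map_smul, shiftC_one, smul_zero, map_smul, map_zero,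
      map_one, map_rat_smul, weight_one, smul_zero, neg_zero]
  | grade1 n =>
    rw [shiftC_ι, polyMould_ι, polyMould_ι]
    ext w
    rcases w with _ | ⟨x, _ | ⟨y, w⟩⟩
    · simp [single, weight_apply]
    · simp only [single, weight_apply, WordMould.neg_apply, List.map_cons, List.map_nil,
        List.sum_singleton]
      ring
    · simp [single, weight_apply]
  | mul P Q hP hQ =>
    rw [shiftC_mul, map_add, map_mul, map_mul, map_mul, hP, hQ, weight_mul]
    noncomm_ring
  | add P Q hP hQ => rw [map_add, map_add, map_add, map_add, hP, hQ, neg_add]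

/-- The mould `ma(F)(u₁, …, u_r) / (u₁ ⋯ u_r)` of a Lie polynomial `F`. -/
noncomputable def lieMould : LieAB →ₗ[ℚ] WordMould S L :=
  (polyMould σ).toLinearMap ∘ₗ toPolyC

theorem lieMould_apply (F : LieAB) : lieMould σ F = polyMould σ (toPolyC F) := rfl

theorem lieMould_lie (F G : LieAB) : lieMould σ ⁅F, G⁆ = ⁅lieMould σ F, lieMould σ G⁆ -
    coeffA F • weight σ (lieMould σ G) + coeffA G • weight σ (lieMould σ F) := by
  simp only [lieMould_apply, toPolyC_lie, map_add, map_sub, map_smul, polyMould_shiftC,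
    Ring.lie_def, map_mul, smul_neg]
  abel

theorem lieMould_genA : lieMould σ genA = 0 := by
  rw [lieMould_apply, toPolyC_genA, map_zero]

theorem lieMould_nil (F : LieAB) : lieMould σ F [] = 0 := by
  induction F using lieAB_induction with
  | genA => rw [lieMould_genA, WordMould.zero_apply]
  | genB => rw [lieMould_apply, toPolyC_genB, polyMould_ι, single_nil]
  | add F G hF hG => rw [map_add, WordMould.add_apply, hF, hG, add_zero]
  | smul c F hF => rw [map_smul, WordMould.smul_apply, hF, smul_zero]
  | lie F G hF hG =>
    simp [lieMould_lie, Ring.lie_def, mul_nil, weight_apply, hF, hG, smul_zero]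

variable {σ} (hσ : ∀ x, σ x ≠ 0)
include hσ

theorem weight_lieMould_genB : weight σ (lieMould σ genB) = single 1 := by
  rw [lieMould_apply, toPolyC_genB, polyMould_ι]
  ext w
  rcases w with _ | ⟨x, _ | ⟨y, w⟩⟩ <;> simp [single, weight_apply, hσ]

theorem lieMould_derivation_genB (D : Der0) {B : WordMould S L}
    (hB : weight σ B = lieMould σ (D.1 genA)) :
    lieMould σ (D.1 genB) = arat B (lieMould σ genB) := by
  obtain ⟨D, hD, hA, hD_genB⟩ := D
  refine eq_of_weight_eq hσ ?_ ?_
  · simp [lieMould_nil, arat_apply, Ring.lie_def, mul_nil, arit_nil]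
  · have h : lieMould σ ⁅D genA, genB⁆ + lieMould σ ⁅genA, D genB⁆ = 0 := by
      rw [← map_add, add_comm, ← D.apply_lie_eq_add, hD, map_zero]
    rw [weight_arat, weight_lieMould_genB hσ, arat_single_one, zero_add, hB, ← sub_eq_zero,
      ← neg_eq_zero, neg_sub, ← h]
    simp [lieMould_lie, lieMould_genA, coeffA_genA, coeffA_genB, hA, hD_genB, sub_eq_add_neg]

theorem lieMould_derivation (D : Der0) {B : WordMould S L}
    (hB : weight σ B = lieMould σ (D.1 genA)) (F : LieAB) :
    lieMould σ (D.1 F) = arat B (lieMould σ F) + coeffA F • weight σ B := by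
  induction F using lieAB_induction with
  | genA => rw [lieMould_genA, map_zero, coeffA_genA, one_smul, zero_add, hB]
  | genB => rw [lieMould_derivation_genB hσ D hB, coeffA_genB, zero_smul, add_zero]
  | add F G hF hG =>
    rw [map_add, map_add, hF, hG, map_add, map_add, map_add, add_smul]
    abel
  | smul c F hF =>
    simp only [map_smul, map_rat_smul, hF, smul_add, smul_eq_mul, mul_smul]
  | lie F G hF hG =>
    obtain ⟨D, hD, hA, hD_genB⟩ := D
    have hc := coeffA_derivation D hA hD_genB
    simp only [D.apply_lie_eq_add, map_add, lieMould_lie, hF, hG, hc, coeffA_lie, zero_smul,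
      sub_zero, add_zero, map_sub, map_rat_smul, arat_lie, weight_arat, add_lie, lie_add, smul_lie,
      lie_smul, smul_add]
    rw [← lie_skew (lieMould σ F) (weight σ B), smul_comm (coeffA F) (coeffA G)]
    simp only [smul_neg]
    abel

theorem eq_ari_of_weight_eq (D₁ D₂ : Der0) {B₁ B₂ B : WordMould S L}
    (nil₁ : B₁ [] = 0) (nil₂ : B₂ [] = 0) (nil : B [] = 0)
    (h₁ : weight σ B₁ = lieMould σ (D₁.1 genA)) (h₂ : weight σ B₂ = lieMould σ (D₂.1 genA))
    (h : weight σ B = lieMould σ (⁅D₁, D₂⁆.1 genA)) : B = WordMould.ari B₁ B₂ := by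
  refine eq_of_weight_eq hσ ?_ ?_
  · simp [nil, WordMould.ari, arit_nil, Ring.lie_def, mul_nil, nil₁, nil₂]
  · have bracket : ⁅D₁, D₂⁆.1 genA = D₁.1 (D₂.1 genA) - D₂.1 (D₁.1 genA) :=
      LieDerivation.lie_apply ..
    rw [h, bracket, map_sub, lieMould_derivation hσ D₁ h₁ (D₂.1 genA),
      lieMould_derivation hσ D₂ h₂ (D₁.1 genA), ← h₁, ← h₂, D₁.2.2.1, D₂.2.2.1]
    simp only [zero_smul, add_zero, arat_apply, arit_weight, WordMould.ari, map_add, map_sub,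
      weight_lie]
    rw [← lie_skew (weight σ B₁) B₂]
    abel

end Action

/-! ### Evaluation of rational moulds on words -/

section Polynomials

theorem basisFreeMonoid_ofList (v : List ℕ) :
    FreeAlgebra.basisFreeMonoid ℚ ℕ (FreeMonoid.ofList v) = (v.map (FreeAlgebra.ι ℚ)).prod := by
  simp [FreeAlgebra.basisFreeMonoid, FreeAlgebra.equivMonoidAlgebraFreeMonoid,
    FreeMonoid.lift_apply]

theorem polyC_induction {p : PolyC → Prop} (word : ∀ v : List ℕ, p (v.map (FreeAlgebra.ι ℚ)).prod)
    (add : ∀ P Q, p P → p Q → p (P + Q)) (smul : ∀ (c : ℚ) P, p P → p (c • P)) (P : PolyC) :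
    p P := by
  induction (FreeAlgebra.basisFreeMonoid ℚ ℕ).mem_span P using Submodule.span_induction with
  | mem _ h =>
    obtain ⟨v, rfl⟩ := h
    exact basisFreeMonoid_ofList v.toList ▸ word v.toList
  | zero => simpa only [zero_smul] using smul 0 _ (word [])
  | add P Q _ _ hP hQ => exact add P Q hP hQ
  | smul c P _ hP => exact smul c P hP

theorem maPoly_word (v : List ℕ) (r : ℕ) : maPoly (v.map (FreeAlgebra.ι ℚ)).prod r =
    if v.length = r then (-1) ^ v.sum * ∏ i : Fin r, MvPolynomial.X i ^ v.getD i 0 else 0 := by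
  rw [← basisFreeMonoid_ofList, maPoly, Module.Basis.constr_basis]
  rfl

theorem aeval_Delta {L : Type*} [CommRing L] [Algebra ℚ L] {r : ℕ} (x : Fin r → L) :
    MvPolynomial.aeval x (Delta r) = (∏ i, x i) * ∑ i, x i := by
  simp [Delta]

theorem algebraMap_eq_aeval_X {r : ℕ} (p : MvPolynomial (Fin r) ℚ) :
    algebraMap _ (RatFun r) p = MvPolynomial.aeval
      (fun i => algebraMap (MvPolynomial (Fin r) ℚ) (RatFun r) (MvPolynomial.X i)) p := by
  have h : IsScalarTower.toAlgHom ℚ (MvPolynomial (Fin r) ℚ) (RatFun r) = MvPolynomial.aeval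
      fun i => algebraMap (MvPolynomial (Fin r) ℚ) (RatFun r) (MvPolynomial.X i) := by
    ext i
    simp
  exact DFunLike.congr_fun h p

end Polynomials

section Evaluation

theorem evalAt_ofFn {L : Type} [Field L] [Algebra ℚ L] (A : Mould) {r : ℕ} (x : Fin r → L) :
    evalAt A (List.ofFn x) = ratEval (A r) x := by
  have cast {n : ℕ} (y : Fin n → L) (h : n = r) (hy : ∀ i, y i = x (i.cast h)) :
      ratEval (A n) y = ratEval (A r) x := by
    subst h
    exact congrArg _ (funext hy)
  exact cast _ List.length_ofFn fun i => List.get_ofFn x i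

theorem ratEval_zero {L : Type} [Field L] [Algebra ℚ L] {m : ℕ} (x : Fin m → L) :
    ratEval (0 : RatFun m) x = 0 := by
  simpa using ratEval_eq 0 x 0 1 (by simp) (by simp)

theorem evalAt_vars (A : Mould) (r : ℕ) : evalAt A (vars r) = A r := by
  rw [vars, evalAt_ofFn, ratEval, ← algebraMap_eq_aeval_X, ← algebraMap_eq_aeval_X]
  exact IsFractionRing.mk'_num_den' _ (A r)

theorem vars_length (r : ℕ) : (vars r).length = r := List.length_ofFn

variable {S L : Type} [Field L] [CharZero L]

/-- The values of a rational mould on the words whose letters `x` stand for the arguments `σ x`. -/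
noncomputable def ofMould (σ : S → L) (A : Mould) : WordMould S L := fun w => evalAt A (w.map σ)

theorem ofMould_apply (σ : S → L) (A : Mould) (w : List S) :
    ofMould σ A w = evalAt A (w.map σ) := rfl

theorem ofMould_nil (σ : S → L) {A : Mould} (hA : A 0 = 0) : ofMould σ A [] = 0 := by
  change ratEval (A 0) ([] : List L).get = 0
  rw [hA, ratEval_zero]

theorem ofMould_zero (σ : S → L) : ofMould σ 0 = 0 := by
  ext w
  exact ratEval_zero _

variable [Add S] (σ : S →ₙ+ L)

open WordMould

variable {σ} (hσ : ∀ x, σ x ≠ 0)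
include hσ

theorem aeval_maPoly_word (v : List ℕ) {r : ℕ} (x : Fin r → S) :
    MvPolynomial.aeval (fun i => σ (x i)) (maPoly (v.map (FreeAlgebra.ι ℚ)).prod r) =
      (∏ i, σ (x i)) * polyMould σ (v.map (FreeAlgebra.ι ℚ)).prod (List.ofFn x) := by
  induction v generalizing r with
  | nil =>
    rw [maPoly_word]
    cases r <;> simp
  | cons n v ih =>
    rw [maPoly_word]
    cases r with
    | zero => simp [polyMould_ι, single_mul_nil]
    | succ r =>
      have ih := maPoly_word v r ▸ ih fun i => x i.succ
      rw [List.map_cons, List.prod_cons, map_mul, polyMould_ι, List.ofFn_succ, single_mul_cons,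
        Fin.prod_univ_succ fun i => σ (x i), mul_mul_mul_comm, ← ih, mul_div_cancel₀ _ (hσ _)]
      simp only [List.length_cons, Nat.add_right_cancel_iff]
      split_ifs
      · simp only [map_mul, map_prod, map_pow, map_neg, map_one, MvPolynomial.aeval_X,
          Fin.prod_univ_succ, List.sum_cons, pow_add, neg_pow (σ (x 0)) n, Fin.val_zero,
          Fin.val_succ, List.getD_cons_zero, List.getD_cons_succ]
        ring
      · rw [map_zero, map_zero, mul_zero]

theorem aeval_maPoly (P : PolyC) {r : ℕ} (x : Fin r → S) :
    MvPolynomial.aeval (fun i => σ (x i)) (maPoly P r) =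
      (∏ i, σ (x i)) * polyMould σ P (List.ofFn x) := by
  induction P using polyC_induction with
  | word v => exact aeval_maPoly_word hσ v x
  | add P Q hP hQ =>
    rw [map_add, map_add, Pi.add_apply, map_add, hP, hQ, WordMould.add_apply, mul_add]
  | smul c P hP =>
    rw [map_smul, map_smul, Pi.smul_apply, map_smul, hP, WordMould.smul_apply, mul_smul_comm]

theorem weight_ofMould_Da (F : LieAB) : weight σ (ofMould σ (Da F).1) = lieMould σ F := by
  ext w
  obtain ⟨r, x, rfl⟩ : ∃ r, ∃ x : Fin r → S, List.ofFn x = w := ⟨_, _, List.ofFn_get w⟩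
  obtain rfl | hr := eq_or_ne r 0
  · rw [List.ofFn_zero, lieMould_nil, weight_apply, List.map_nil, List.sum_nil, zero_mul]
  have prod_ne_zero : ∏ i, σ (x i) ≠ 0 := prod_ne_zero_iff.2 fun i _ => hσ (x i)
  have sum_ne_zero : ∑ i, σ (x i) ≠ 0 := by
    obtain ⟨y, hy⟩ := exists_map_eq_sum (σ := σ) (w := List.ofFn x) (by simpa using hr)
    rw [← List.sum_ofFn, ← Function.comp_def, ← List.map_ofFn, ← hy]
    exact hσ y
  have aeval_Delta_ne_zero : MvPolynomial.aeval (fun i => σ (x i)) (Delta r) ≠ 0 :=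
    aeval_Delta (fun i => σ (x i)) ▸ mul_ne_zero prod_ne_zero sum_ne_zero
  have fraction : (Da F).1 r * algebraMap _ (RatFun r) (Delta r) = algebraMap _ _ (ma F r) := by
    change (if r = 0 then 0 else _) * _ = _
    rw [if_neg hr, div_mul_cancel₀]
    exact (map_ne_zero_iff _ (IsFractionRing.injective _ _)).2 fun h =>
      aeval_Delta_ne_zero (by rw [h, map_zero])
  rw [weight_apply, ofMould_apply, List.map_ofFn, List.sum_ofFn, evalAt_ofFn, Function.comp_def,
    ratEval_eq _ _ _ _ aeval_Delta_ne_zero fraction, aeval_Delta, ma, LinearMap.comp_apply,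
    aeval_maPoly hσ, mul_div_mul_left _ _ prod_ne_zero,
    mul_div_cancel₀ _ sum_ne_zero, lieMould_apply]

end Evaluation

section Comparison

open WordMould

theorem contract_eq_sum {S R : Type*} [CommRing R]
    (τ : List S → List S → List S → WordMould S R →ₗ[R] R) {B : WordMould S R} (hB : B [] = 0)
    (A : WordMould S R) (w : List S) : contract τ B A w =
      ∑ l ∈ range (w.length + 1), ∑ k ∈ range l,
        τ (w.take k) ((w.take l).drop k) (w.drop l) A * B ((w.take l).drop k) := by
  rw [contract_apply, splitSum]
  refine sum_congr rfl fun l hl => ?_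
  have length_take : (w.take l).length = l := by
    rw [List.length_take, min_eq_left (Nat.lt_succ_iff.1 (mem_range.1 hl))]
  rw [splitSum, length_take, sum_range_succ, List.drop_eq_nil_of_le length_take.le, hB, mul_zero,
    add_zero]
  refine sum_congr rfl fun k hk => ?_
  rw [List.take_take, min_eq_left (mem_range.1 hk).le]

variable {S : Type} [Add S] (A : Mould)

section Evaluation

variable {L : Type} [Field L] [CharZero L] (σ : S →ₙ+ L)

theorem evalLeft_ofMould (a b : List S) {c : List S} (hc : c ≠ []) :
    evalLeft a b c (ofMould σ A) = evalAt A (flexLeft (a.map σ) (b.map σ) (c.map σ)) := by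
  obtain ⟨z, c, rfl⟩ := List.exists_cons_of_ne_nil hc
  simp [evalLeft, ofMould_apply, flexLeft, map_foldr_add]

theorem evalRight_ofMould {a : List S} (b c : List S) (ha : a ≠ []) :
    evalRight a b c (ofMould σ A) = evalAt A (flexRight (a.map σ) (b.map σ) (c.map σ)) := by
  obtain ⟨a, x, rfl⟩ := a.eq_nil_or_concat'.resolve_left ha
  simp [evalRight_concat, ofMould_apply, flexRight, map_foldl_add]

end Evaluation

variable {r : ℕ} (σ : S →ₙ+ RatFun r) {w : List S} (hw : w.map σ = vars r)
include hw

theorem length_eq_of_map_eq_vars : w.length = r := by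
  rw [← w.length_map σ, hw, vars_length]

theorem ofMould_eq : ofMould σ A w = A r := by
  rw [ofMould_apply, hw, evalAt_vars]

theorem mu_eq_mul (B : Mould) : mu A B r = (ofMould σ A * ofMould σ B) w := by
  simp only [mu, mul_apply, splitSum, ofMould_apply, List.map_take, List.map_drop, hw,
    length_eq_of_map_eq_vars σ hw]

theorem contract_evalLeft_ofMould {B : Mould} (hB : B 0 = 0) :
     contract evalLeft (ofMould σ B) (ofMould σ A) w =
    ∑ l ∈ range r, ∑ k ∈ range l,
      evalAt A (flexLeft ((vars r).take k) (((vars r).take l).drop k) ((vars r).drop l)) *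
        evalAt B (((vars r).take l).drop k) := by
  have length_w := length_eq_of_map_eq_vars σ hw
  rw [contract_eq_sum _ (ofMould_nil σ hB), length_w, sum_range_succ,
    sum_eq_zero (s := range r) (f := fun k => evalLeft _ _ (w.drop r) _ * _), add_zero]
  · refine sum_congr rfl fun l hl => sum_congr rfl fun k _ => ?_
    rw [evalLeft_ofMould, ofMould_apply]
    · simp only [List.map_take, List.map_drop, hw]
    · rw [Ne, List.drop_eq_nil_iff, length_w]
      exact not_le.2 (mem_range.1 hl)
  · intro k _
    rw [List.drop_eq_nil_of_le length_w.le, evalLeft, LinearMap.zero_apply, zero_mul]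

theorem contract_evalRight_ofMould {B : Mould} (hB : B 0 = 0) :
     contract evalRight (ofMould σ B) (ofMould σ A) w =
    ∑ l ∈ Icc 1 r, ∑ k ∈ Ico 1 l,
      evalAt A (flexRight ((vars r).take k) (((vars r).take l).drop k) ((vars r).drop l)) *
        evalAt B (((vars r).take l).drop k) := by
  have length_w := length_eq_of_map_eq_vars σ hw
  rw [contract_eq_sum _ (ofMould_nil σ hB), length_w, range_eq_Ico,
    sum_eq_sum_Ico_succ_bot r.succ_pos, range_zero, sum_empty, zero_add]
  refine sum_congr rfl fun l hl => ?_
  obtain ⟨hl, hlr⟩ := mem_Ico.1 hl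
  rw [range_eq_Ico, sum_eq_sum_Ico_succ_bot hl, List.take_zero, evalRight_nil,
    LinearMap.zero_apply, zero_mul, zero_add]
  refine sum_congr rfl fun k hk => ?_
  rw [evalRight_ofMould, ofMould_apply]
  · simp only [List.map_take, List.map_drop, hw]
  · have := mem_Ico.1 hk
    rw [Ne, List.take_eq_nil_iff, ← List.length_eq_zero_iff, length_w]
    omega

theorem arit_eq_arit {B : Mould} (hB : B 0 = 0) :
     arit B A r = WordMould.arit (ofMould σ B) (ofMould σ A) w := by
  rw [WordMould.arit, LinearMap.sub_apply, WordMould.sub_apply, contract_evalLeft_ofMould A σ hw hB,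
    contract_evalRight_ofMould A σ hw hB]
  rfl

theorem ari_eq_ari (A B : ARI) :
    (ari A B).1 r = WordMould.ari (ofMould σ A.1) (ofMould σ B.1) w := by
  rw [WordMould.ari, Ring.lie_def]
  simp only [WordMould.add_apply, WordMould.sub_apply, ← arit_eq_arit _ σ hw A.2,
    ← arit_eq_arit _ σ hw B.2, ← mu_eq_mul _ σ hw]
  rfl

end Comparison

section GenericPoint

/-- The polynomials that are positive at `(1, …, 1)`: a semigroup of nonzero elements of
`ℚ(u₁, …, u_r)` that contains the variables. -/
def posCone (r : ℕ) : AddSubsemigroup (RatFun r) where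
  carrier := {x | ∃ p : MvPolynomial (Fin r) ℚ,
    0 < MvPolynomial.eval (fun _ => 1) p ∧ algebraMap _ (RatFun r) p = x}
  add_mem' := by
    rintro _ _ ⟨p, hp, rfl⟩ ⟨q, hq, rfl⟩
    exact ⟨p + q, by rw [map_add]; exact add_pos hp hq, map_add _ _ _⟩

/-- The inclusion of `posCone r` into the field of rational functions. -/
noncomputable def coneIncl (r : ℕ) : posCone r →ₙ+ RatFun r := AddMemClass.subtype (posCone r)

theorem coneIncl_ne_zero {r : ℕ} (x : posCone r) : coneIncl r x ≠ 0 := by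
  obtain ⟨_, p, hp, rfl⟩ := x
  refine (map_ne_zero_iff _ (IsFractionRing.injective (MvPolynomial (Fin r) ℚ) (RatFun r))).2 ?_
  rintro rfl
  exact hp.ne' (map_zero _)

/-- The `i`-th variable. -/
noncomputable def coneVar {r : ℕ} (i : Fin r) : posCone r :=
  ⟨algebraMap (MvPolynomial (Fin r) ℚ) (RatFun r) (MvPolynomial.X i), MvPolynomial.X i,
    by simp, rfl⟩

theorem map_coneVar (r : ℕ) : (List.ofFn coneVar).map (coneIncl r) = vars r :=
  List.map_ofFn ..

theorem Psi_lie (D₁ D₂ : Der0) : Psi ⁅D₁, D₂⁆ = ari (Psi D₁) (Psi D₂) := by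
  ext r
  rw [ari_eq_ari (coneIncl r) (map_coneVar r), ← ofMould_eq (Psi _).1 (coneIncl r) (map_coneVar r)]
  refine congrFun (eq_ari_of_weight_eq coneIncl_ne_zero D₁ D₂ ?_ ?_ ?_ ?_ ?_ ?_) _
  iterate 3 exact ofMould_nil _ (Psi _).2
  iterate 3 exact weight_ofMould_Da coneIncl_ne_zero _

end GenericPoint

/-! ### Injectivity -/

section Injectivity

theorem coeff_maPoly_word (u v : List ℕ) :
    MvPolynomial.coeff (Finsupp.equivFunOnFinite.symm v.get)
      (maPoly (u.map (FreeAlgebra.ι ℚ)).prod v.length) = if u = v then (-1) ^ v.sum else 0 := by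
  rw [maPoly_word]
  by_cases h_len : u.length = v.length
  swap
  · rw [if_neg h_len, if_neg (mt (congrArg _) h_len), MvPolynomial.coeff_zero]
  have exponent : Finsupp.equivFunOnFinite.symm (fun i : Fin v.length => u.getD i 0) =
      Finsupp.equivFunOnFinite.symm v.get ↔ u = v := by
    rw [Equiv.apply_eq_iff_eq]
    refine ⟨fun h => List.ext_get h_len fun i hu hv => ?_, ?_⟩
    · simpa [hu] using congrFun h ⟨i, hv⟩
    · rintro rfl
      simp [funext_iff]
  have monomial : (∏ i : Fin v.length, MvPolynomial.X i ^ u.getD i 0 : MvPolynomial _ ℚ) =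
      MvPolynomial.monomial
        (Finsupp.equivFunOnFinite.symm fun i : Fin v.length => u.getD i 0) 1 := by
    rw [MvPolynomial.monomial_eq, Finsupp.prod_fintype _ _ fun _ => pow_zero _]
    simp
  rw [if_pos h_len, monomial, ← MvPolynomial.C_1, ← MvPolynomial.C_neg, ← MvPolynomial.C_pow,
    MvPolynomial.coeff_C_mul, MvPolynomial.coeff_monomial, mul_ite, mul_one, mul_zero]
  simp only [exponent]
  split_ifs with h
  exacts [h ▸ rfl, rfl]

theorem repr_eq_coeff_maPoly (P : PolyC) (v : List ℕ) :
    (FreeAlgebra.basisFreeMonoid ℚ ℕ).repr P (FreeMonoid.ofList v) = (-1) ^ v.sum *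
      MvPolynomial.coeff (Finsupp.equivFunOnFinite.symm v.get) (maPoly P v.length) := by
  induction P using polyC_induction with
  | word u =>
    rw [coeff_maPoly_word, ← basisFreeMonoid_ofList, Module.Basis.repr_self]
    obtain rfl | huv := eq_or_ne u v
    · rw [if_pos rfl, Finsupp.single_eq_same, ← mul_pow, neg_one_mul, neg_neg, one_pow]
    · rw [if_neg huv, mul_zero, Finsupp.single_eq_of_ne (FreeMonoid.ofList.injective.ne huv.symm)]
  | add P Q hP hQ =>
    rw [map_add, map_add, Pi.add_apply, Finsupp.add_apply, MvPolynomial.coeff_add, hP, hQ, mul_add]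
  | smul c P hP =>
    rw [map_smul, map_smul, Pi.smul_apply, Finsupp.smul_apply, MvPolynomial.coeff_smul, hP,
      mul_smul_comm]

theorem maPoly_injective : Function.Injective maPoly := by
  refine (injective_iff_map_eq_zero _).2 fun P hP => ?_
  refine (FreeAlgebra.basisFreeMonoid ℚ ℕ).ext_elem fun v => ?_
  rw [← FreeMonoid.ofList_toList v, repr_eq_coeff_maPoly, hP]
  simp

theorem eq_zero_of_lieMould_eq_zero {F : LieAB} (hF : coeffA F = 0)
    (h : ∀ r, lieMould (coneIncl r) F = 0) : F = 0 := by
  refine toPolyC_eq_zero hF (maPoly_injective (funext fun r => ?_))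
  apply IsFractionRing.injective (MvPolynomial (Fin r) ℚ) (RatFun r)
  refine (algebraMap_eq_aeval_X _).trans ((aeval_maPoly coneIncl_ne_zero _ coneVar).trans ?_)
  rw [← lieMould_apply, h, WordMould.zero_apply, mul_zero, map_zero]
  simp

theorem Psi_injective : Function.Injective Psi := by
  refine (injective_iff_map_eq_zero _).2 fun D hD => ?_
  have weight_zero (r : ℕ) :
      WordMould.weight (coneIncl r) 0 = lieMould (coneIncl r) (D.1 genA) := by
    have hDa : (Da (D.1 genA)).1 = 0 := congrArg Subtype.val hD
    rw [← weight_ofMould_Da coneIncl_ne_zero, hDa, ofMould_zero]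
  have hA : D.1 genA = 0 := eq_zero_of_lieMould_eq_zero D.2.2.1 fun r => by
    rw [← weight_zero, map_zero]
  have hB : D.1 genB = 0 := eq_zero_of_lieMould_eq_zero D.2.2.2 fun r => by
    rw [lieMould_derivation_genB coneIncl_ne_zero D (weight_zero r)]
    exact WordMould.arat_zero _
  refine Subtype.ext (LieDerivation.ext_of_lieSpan_eq_top _ lieSpan_range_of ?_)
  rintro _ ⟨i, rfl⟩
  fin_cases i
  exacts [hA, hB]

end Injectivity

end EllipticMould

theorem theoremB3 :
    Function.Injective EllipticMould.Psi ∧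
      ∀ D₁ D₂ : EllipticMould.Der0,
        EllipticMould.Psi ⁅D₁, D₂⁆ = EllipticMould.ari (EllipticMould.Psi D₁) (EllipticMould.Psi D₂) :=
  ⟨EllipticMould.Psi_injective, EllipticMould.Psi_lie⟩
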